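/- Let $d\ge 1$ be an integer, let $\alpha>-1$ be real, and let $B^d$ be the open Euclidean unit ball of $\mathbb{R}^d$. For real $\beta$ put $W_\beta(x)=(1-\|x\|^2)^\beta$ on $B^d$. Let $\mathrm{L}^2_\alpha$ be the weighted Lebesgue space on $B^d$ with inner product $\langle u,v\rangle_\alpha=\int_{B^d}u\,\overline{v}\,W_\alpha\,dx$, let $\langle\nabla u,\nabla v\rangle_\alpha=\sum_{j=1}^d\langle\partial_ju,\partial_jv\rangle_\alpha$, let $c_\alpha=\langle 1,1\rangle_\alpha$, and put $$\langle u,v\rangle_{\alpha,1}=\langle\nabla u,\nabla v\rangle_\alpha+c_\alpha^{-1}\,\langle u,1\rangle_\alpha\,\overline{\langle v,1\rangle_\alpha}.$$ Let $\Pi^d_n$ be the space of polynomials in $d$ variables (with coefficients in $\mathbb{R}$ or in $\mathbb{C}$) of total degree at most $n$, with $\Pi^d_{-1}=\{0\}$, and for $n\ge 0$ let $$\mathcal{V}^{\alpha}_n=\{p\in\Pi^d_n:\langle p,q\rangle_{\alpha}=0\ \text{for all}\ q\in\Pi^d_{n-1}\},\qquad \mathcal{V}^{\alpha,1}_n=\{p\in\Pi^d_n:\langle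 p,q\rangle_{\alpha,1}=0\ \text{for all}\ q\in\Pi^d_{n-1}\}.$$ Let $\mathrm{proj}^\alpha_0$ be the orthogonal projection from $\mathrm{L}^2_\alpha$ onto $\mathcal{V}^\alpha_0$ (the constants). For real $\beta$ and twice differentiable $q$ on $B^d$ let $$\mathcal{L}^{(\beta)}(q)=-W_\beta^{-1}\,\mathrm{div}\left(W_{\beta+1}\nabla q\right)-\sum_{1\le i<j\le d}(x_i\partial_j-x_j\partial_i)^2q,$$ and, when moreover $x\cdot\nabla q\in\mathrm{L}^2_\alpha$, let $$\tilde{\mathcal{L}}^{(\alpha)}(q)=\mathcal{L}^{(\alpha-1)}(q)+2\,\mathrm{proj}^\alpha_0(x\cdot\nabla q).$$ **Theorem.** For every integer $n\ge 0$ and every $p_n\in\mathcal{V}^{\alpha,1}_n$, $$\tilde{\mathcal{L}}^{(\alpha)}(p_n)=n(n+d+2\alpha-2)\,p_n\qquad\text{on } B^d.$$ -/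

import Mathlib

namespace BallOP

noncomputable section

variable {𝕜 : Type*} [RCLike 𝕜] {d : ℕ}

/-- The weight `W_α(x) = (1 - ‖x‖²)^α`, of interest on the open Euclidean unit ball `B^d`. -/
def weight (α : ℝ) (x : EuclideanSpace ℝ (Fin d)) : ℝ := (1 - ‖x‖ ^ 2) ^ α

/-- `⟨u, v⟩_α = ∫_{B^d} u(x) conj(v(x)) W_α(x) dx`. -/
def innerL2 (α : ℝ) (u v : EuclideanSpace ℝ (Fin d) → 𝕜) : 𝕜 :=
  ∫ x in Metric.ball (0 : EuclideanSpace ℝ (Fin d)) 1,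
    u x * (starRingEnd 𝕜) (v x) * ((weight α x : ℝ) : 𝕜)

/-- The partial derivative `∂_j u`. -/
def partialD (j : Fin d) (u : EuclideanSpace ℝ (Fin d) → 𝕜) (x : EuclideanSpace ℝ (Fin d)) : 𝕜 :=
  lineDeriv ℝ u x (EuclideanSpace.single j (1 : ℝ))

/-- The angular derivative `D_{i,j} u = x_i ∂_j u - x_j ∂_i u`. -/
def angularD (i j : Fin d) (u : EuclideanSpace ℝ (Fin d) → 𝕜) (x : EuclideanSpace ℝ (Fin d)) : 𝕜 :=
  ((x i : ℝ) : 𝕜) * partialD j u x - ((x j : ℝ) : 𝕜) * partialD i u x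

/-- The radial derivative `x · ∇u`. -/
def radialD (u : EuclideanSpace ℝ (Fin d) → 𝕜) (x : EuclideanSpace ℝ (Fin d)) : 𝕜 :=
  ∑ j, ((x j : ℝ) : 𝕜) * partialD j u x

/-- `⟨u, v⟩_{α,1} = ⟨∇u, ∇v⟩_α + c_α⁻¹ ⟨u, 1⟩_α conj(⟨v, 1⟩_α)`, where `c_α = ⟨1, 1⟩_α`. -/
def innerH1 (α : ℝ) (u v : EuclideanSpace ℝ (Fin d) → 𝕜) : 𝕜 :=
  ∑ j, innerL2 α (partialD j u) (partialD j v)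
    + (innerL2 α (fun _ : EuclideanSpace ℝ (Fin d) => (1 : 𝕜)) (fun _ => 1))⁻¹
      * innerL2 α u (fun _ => 1) * (starRingEnd 𝕜) (innerL2 α v (fun _ => 1))

/-- The function on `ℝ^d` given by a polynomial in `d` variables. -/
def polyFun (p : MvPolynomial (Fin d) 𝕜) (x : EuclideanSpace ℝ (Fin d)) : 𝕜 :=
  MvPolynomial.eval (fun i => ((x i : ℝ) : 𝕜)) p

/-- `𝒱^α_n`: the polynomials of total degree at most `n` that are orthogonal, with respect to
`⟨·, ·⟩_α`, to all polynomials of total degree at most `n - 1` (to none but `0` if `n = 0`). -/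
def orthoL2 (𝕜 : Type*) [RCLike 𝕜] (d : ℕ) (α : ℝ) (n : ℕ) : Set (MvPolynomial (Fin d) 𝕜) :=
  {p | p.totalDegree ≤ n ∧
    ∀ q : MvPolynomial (Fin d) 𝕜, q.totalDegree < n → innerL2 α (polyFun p) (polyFun q) = 0}

/-- `𝒱^{α,1}_n`: the polynomials of total degree at most `n` that are orthogonal, with respect to
`⟨·, ·⟩_{α,1}`, to all polynomials of total degree at most `n - 1` (to none but `0` if `n = 0`). -/
def orthoH1 (𝕜 : Type*) [RCLike 𝕜] (d : ℕ) (α : ℝ) (n : ℕ) : Set (MvPolynomial (Fin d) 𝕜) :=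
  {p | p.totalDegree ≤ n ∧
    ∀ q : MvPolynomial (Fin d) 𝕜, q.totalDegree < n → innerH1 α (polyFun p) (polyFun q) = 0}

/-- `p` is the orthogonal projection of `u ∈ L²_α` onto `𝒱^α_n`: it lies in `𝒱^α_n`, and `u - p` is
orthogonal to `𝒱^α_n`. -/
def IsProjL2 (α : ℝ) (n : ℕ) (u : EuclideanSpace ℝ (Fin d) → 𝕜) (p : MvPolynomial (Fin d) 𝕜) :
    Prop :=
  p ∈ orthoL2 𝕜 d α n ∧
    ∀ q ∈ orthoL2 𝕜 d α n, innerL2 α (fun x => u x - polyFun p x) (polyFun q) = 0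

/-- The orthogonal projection `proj^α_n` from `L²_α` onto `𝒱^α_n`. For `α > -1` and `u ∈ L²_α` there
is exactly one polynomial `p` with `IsProjL2 α n u p`, and `projL2 α n u` is its function. -/
def projL2 (α : ℝ) (n : ℕ) (u : EuclideanSpace ℝ (Fin d) → 𝕜) : EuclideanSpace ℝ (Fin d) → 𝕜 :=
  polyFun (Classical.epsilon (IsProjL2 α n u))

/-- `ℒ^{(α)} q = -W_α⁻¹ div(W_{α+1} ∇q) - ∑_{i<j} D_{i,j}² q`, an operator on functions that are
twice differentiable in the open unit ball. -/
def opL (α : ℝ) (q : EuclideanSpace ℝ (Fin d) → 𝕜) (x : EuclideanSpace ℝ (Fin d)) : 𝕜 :=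
  -(((weight α x)⁻¹ : ℝ) : 𝕜)
      * ∑ j, partialD j (fun y => ((weight (α + 1) y : ℝ) : 𝕜) * partialD j q y) x
    - ∑ i, ∑ j ∈ Finset.Ioi i, angularD i j (angularD i j q) x

/-- The rank-one perturbation `ℒ̃^{(α)} q = ℒ^{(α-1)} q + 2 proj^α_0 (x · ∇q)`. -/
def opTildeL (α : ℝ) (q : EuclideanSpace ℝ (Fin d) → 𝕜) (x : EuclideanSpace ℝ (Fin d)) : 𝕜 :=
  opL (α - 1) q x + 2 * projL2 α 0 (radialD q) x

end

end BallOP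

/-!
# Sobolev orthogonal polynomials on the ball are eigenfunctions

Write `E = x · ∇` and `M_k = -Δ + E² + k E`. On polynomials `ℒ^{(α-1)}` is `M_{d+2α-2}`
(`opL_polyFun`, by the Casimir identity `sum_Ioi_angular_angular`), so that `ℒ̃^{(α)}`
is `p ↦ M_{d+2α-2} p` plus twice the mean value of `E p` (`ballOpTilde`). On
polynomials of degree at most `n` this operator is multiplication by `n (n + d + 2 α - 2)` up to terms of degree less than `n`
(`totalDegree_ballOpTilde_sub_lt`). If it is symmetric for `⟨·, ·⟩_{α,1}`, the defect
`f = ℒ̃^{(α)} p - n (n + d + 2 α - 2) p` for `p ∈ 𝒱^{α,1}_n` is orthogonal to all polynomials of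
degree less than `n`, hence to itself, and vanishes on the ball
(`polyFun_eq_zero_of_innerH1_self`).

The symmetry is `IsBallFunctional.sobolevForm_ballOpTilde`. The mean value of `ℒ̃^{(α)} p` is zero,
and `∂_j ℒ^{(α-1)} = (ℒ^{(α)} + d + 2 α - 1) ∂_j` (`pderiv_ballOp`), so it follows from the symmetry
of `ℒ^{(α)}` in `L²_α` (`IsBallFunctional.apply_ballOp_mul`).

All integrals enter through the functional `A(p) = ∫ p W_α` on polynomials (complex conjugation is
moved to the coefficients), and the symmetry uses of `A` only `A(1) ≠ 0` and the integration by
parts `A((1 - r²) ∂_j g) = 2 (α + 1) A(x_j g)` (`IsBallFunctional`). Applied to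
`x_j h` and summed over `j` it gives
`2 (α + 1) A(h) = A((1 - r²) (E + d + 2 α + 2) h)`; combining the two, the factor `1 - r²` can be
removed: `A(∂_j g) = A((E + d + 2 α) (x_j g))` (`IsBallFunctional.apply_pderiv`). This avoids
integrating the angular derivatives by parts, which is delicate as `W_α` is unbounded for `α < 0`.
-/

namespace BallOP

open MvPolynomial

/-! ### Differential operators on polynomials -/

section Algebra

variable {K : Type*} [Field K] {d : ℕ}

/-- The Euler operator `E = ∑ j, x_j ∂_j` on polynomials, as the derivation that fixes every
variable. -/
noncomputable def euler (K : Type*) [Field K] (d : ℕ) :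
    Derivation K (MvPolynomial (Fin d) K) (MvPolynomial (Fin d) K) :=
  mkDerivation K X

/-- The Laplacian on polynomials. -/
noncomputable def laplace (K : Type*) [Field K] (d : ℕ) :
    MvPolynomial (Fin d) K →ₗ[K] MvPolynomial (Fin d) K :=
  ∑ j, (pderiv j).toLinearMap ∘ₗ (pderiv j).toLinearMap

/-- The polynomial `x_1² + ⋯ + x_d²`. -/
noncomputable def sqNorm (K : Type*) [Field K] (d : ℕ) : MvPolynomial (Fin d) K :=
  ∑ j, X j ^ 2

/-- The operator `-Δ + E² + k E`. For `k = d + 2 α` it is `ℒ^{(α)}` on polynomials. -/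
noncomputable def ballOp (k : K) (p : MvPolynomial (Fin d) K) : MvPolynomial (Fin d) K :=
  -laplace K d p + euler K d (euler K d p) + k • euler K d p

lemma laplace_apply (p : MvPolynomial (Fin d) K) :
    laplace K d p = ∑ j, pderiv j (pderiv j p) := by
  simp [laplace]

lemma euler_X (j : Fin d) : euler K d (X j) = X j := mkDerivation_X _ _ _

lemma euler_apply (p : MvPolynomial (Fin d) K) : euler K d p = ∑ j, X j * pderiv j p := by
  induction p using MvPolynomial.induction_on with
  | C a => simp
  | add p q hp hq => simp [hp, hq, mul_add, Finset.sum_add_distrib]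
  | mul_X p i hp =>
    simp only [Derivation.leibniz, smul_eq_mul, euler_X, pderiv_X, hp, mul_add,
      Finset.sum_add_distrib, Pi.single_apply, Finset.mul_sum]
    congr 1
    · simp [mul_comm]
    · exact Finset.sum_congr rfl fun j _ => by ring

lemma pderiv_comm (i j : Fin d) (p : MvPolynomial (Fin d) K) :
    pderiv i (pderiv j p) = pderiv j (pderiv i p) := by
  have h : ⁅(pderiv i : Derivation K (MvPolynomial (Fin d) K) (MvPolynomial (Fin d) K)),
      pderiv j⁆ = (0 : Derivation K _ (MvPolynomial (Fin d) K)) := by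
    refine derivation_ext fun l => ?_
    simp [Derivation.commutator_apply, pderiv_X, Pi.single_apply, apply_ite (pderiv _)]
  have := congrArg (fun D => D p) h
  simpa [Derivation.commutator_apply, sub_eq_zero] using this

lemma pderiv_euler (j : Fin d) (p : MvPolynomial (Fin d) K) :
    pderiv j (euler K d p) = euler K d (pderiv j p) + pderiv j p := by
  have h : ⁅(pderiv j : Derivation K (MvPolynomial (Fin d) K) (MvPolynomial (Fin d) K)),
      euler K d⁆ = pderiv j := by
    refine derivation_ext fun l => ?_
    simp [Derivation.commutator_apply, euler_X, pderiv_X, Pi.single_apply,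
      apply_ite (euler K d)]
  have := congrArg (fun D => D p) h
  simp only [Derivation.commutator_apply] at this
  rw [← sub_eq_iff_eq_add']
  exact this

lemma pderiv_laplace (j : Fin d) (p : MvPolynomial (Fin d) K) :
    pderiv j (laplace K d p) = laplace K d (pderiv j p) := by
  simp only [laplace_apply, map_sum, pderiv_comm j]

lemma euler_mul (p q : MvPolynomial (Fin d) K) :
    euler K d (p * q) = euler K d p * q + p * euler K d q := by
  rw [Derivation.leibniz]; simp only [smul_eq_mul]; ring

/-- `∂_j` raises the parameter `k = d + 2 α - 2` of `ℒ^{(α-1)}` to that of `ℒ^{(α)}`. -/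
lemma pderiv_ballOp (k : K) (j : Fin d) (p : MvPolynomial (Fin d) K) :
    pderiv j (ballOp k p) = ballOp (k + 2) (pderiv j p) + (k + 1) • pderiv j p := by
  simp only [ballOp, map_add, map_neg, pderiv_laplace, pderiv_euler, Derivation.map_smul]
  module

lemma coeff_euler (p : MvPolynomial (Fin d) K) (m : Fin d →₀ ℕ) :
    coeff m (euler K d p) = m.degree * coeff m p := by
  classical
  induction p using MvPolynomial.induction_on' with
  | add p q hp hq => simp [hp, hq, mul_add]
  | monomial n a =>
    have h : euler K d (monomial n a) = monomial n (n.degree * a) := by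
      rw [euler_apply]
      simp only [X_mul_pderiv_monomial, ← Finset.sum_smul]
      rw [← Finsupp.degree_eq_sum, smul_monomial, nsmul_eq_mul]
    rw [h, coeff_monomial, coeff_monomial]
    split_ifs with hn
    · rw [hn]
    · simp

lemma coeff_laplace_eq_zero {p : MvPolynomial (Fin d) K} {m : Fin d →₀ ℕ}
    (h : p.totalDegree < m.degree + 2) : coeff m (laplace K d p) = 0 := by
  rw [laplace_apply, coeff_sum]
  refine Finset.sum_eq_zero fun j _ => ?_
  rw [coeff_pderiv, coeff_pderiv, coeff_eq_zero_of_totalDegree_lt]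
  · simp
  · change _ < Finsupp.degree _
    simpa [map_add, add_assoc] using h

lemma totalDegree_lt_of_coeff {p : MvPolynomial (Fin d) K} {n : ℕ} (hn : 0 < n)
    (h : ∀ m : Fin d →₀ ℕ, n ≤ m.degree → coeff m p = 0) : p.totalDegree < n := by
  rw [totalDegree, Finset.sup_lt_iff hn]
  intro m hm
  by_contra! hc
  exact mem_support_iff.1 hm (h m hc)

/-- `-Δ + E² + k E` acts on the part of degree `n` of a polynomial of degree `n` as
multiplication by `n (n + k)`, up to terms of lower degree. -/
lemma totalDegree_ballOp_sub_lt (k : K) {p : MvPolynomial (Fin d) K} {n : ℕ} (hn : 0 < n)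
    (hp : p.totalDegree ≤ n) : (ballOp k p - ((n : K) * (n + k)) • p).totalDegree < n := by
  refine totalDegree_lt_of_coeff hn fun m hm => ?_
  simp only [ballOp, coeff_sub, coeff_add, coeff_neg, coeff_smul, coeff_euler, smul_eq_mul]
  rw [coeff_laplace_eq_zero (by omega)]
  rcases hm.eq_or_lt with rfl | hm
  · ring
  · rw [coeff_eq_zero_of_totalDegree_lt (by change _ < Finsupp.degree _; omega)]
    ring

lemma totalDegree_ballOp_lt (k : K) {p : MvPolynomial (Fin d) K} {n : ℕ}
    (hp : p.totalDegree < n) : (ballOp k p).totalDegree < n := by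
  refine totalDegree_lt_of_coeff (by omega) fun m hm => ?_
  simp only [ballOp, coeff_add, coeff_neg, coeff_smul, coeff_euler, smul_eq_mul]
  rw [coeff_laplace_eq_zero (by omega),
    coeff_eq_zero_of_totalDegree_lt (by change _ < Finsupp.degree _; omega)]
  ring

/-! ### Green's formula from one rule of integration by parts -/

/-- A linear functional on polynomials that obeys the rule of integration by parts
`∫ ∂_j g (1 - r²)^{a+1} = 2 (a + 1) ∫ x_j g (1 - r²)^a` of integration against `(1 - r²)^a` over
the unit ball. -/
def IsBallFunctional (a : K) (A : MvPolynomial (Fin d) K →ₗ[K] K) : Prop :=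
  ∀ j g, A ((1 - sqNorm K d) * pderiv j g) = 2 * (a + 1) * A (X j * g)

namespace IsBallFunctional

variable {a : K} {A : MvPolynomial (Fin d) K →ₗ[K] K}

/-- The radial form of the integration by parts: it compares the weights `(1 - r²)^a` and
`(1 - r²)^{a+1}` on homogeneous polynomials without polar coordinates. -/
lemma radial (hA : IsBallFunctional a A) (h : MvPolynomial (Fin d) K) :
    A ((1 - sqNorm K d) * (euler K d h + (d + 2 * a + 2) • h)) = 2 * (a + 1) * A h := by
  have h1 : ∑ j, A ((1 - sqNorm K d) * pderiv j (X j * h))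
      = 2 * (a + 1) * A (sqNorm K d * h) := by
    rw [Finset.sum_congr rfl fun j _ => hA j (X j * h), ← Finset.mul_sum, ← map_sum, sqNorm,
      Finset.sum_mul]
    simp only [sq, mul_assoc]
  have h2 : ∑ j, pderiv j (X j * h) = euler K d h + (d : K) • h := by
    simp only [pderiv_mul, pderiv_X_self, Finset.sum_add_distrib, euler_apply]
    simp [add_comm, Algebra.smul_def]
  rw [← map_sum, ← Finset.mul_sum, h2] at h1
  have h3 : (1 - sqNorm K d) * (euler K d h + (d + 2 * a + 2) • h)
      = (1 - sqNorm K d) * (euler K d h + (d : K) • h)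
        + (2 * (a + 1)) • (h - sqNorm K d * h) := by
    simp only [Algebra.smul_def, map_add, map_mul, map_one]; ring
  rw [h3, map_add, h1, map_smul, map_sub, smul_eq_mul]
  ring

/-- Integration by parts along the field `e_j - x_j x`, which is tangential on the unit sphere: the
weight is not raised. -/
lemma apply_pderiv (hA : IsBallFunctional a A) (ha : 2 * (a + 1) ≠ 0) (j : Fin d)
    (g : MvPolynomial (Fin d) K) :
    A (pderiv j g) = A (euler K d (X j * g) + (d + 2 * a) • (X j * g)) := by
  apply mul_left_cancel₀ ha
  rw [← hA.radial]
  have h1 : euler K d (pderiv j g) + (d + 2 * a + 2) • pderiv j g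
      = pderiv j (euler K d g + (d + 2 * a + 1) • g) := by
    rw [map_add, pderiv_euler, Derivation.map_smul]; module
  rw [h1, hA]
  congr 2
  rw [euler_mul, euler_X]
  simp only [Algebra.smul_def, map_add, map_one]
  ring

/-- Green's formula: `ℒ^{(a)}` is symmetric. -/
lemma apply_ballOp_mul (hA : IsBallFunctional a A) (ha : 2 * (a + 1) ≠ 0)
    (u v : MvPolynomial (Fin d) K) :
    A (ballOp (d + 2 * a) u * v)
      = ∑ j, A (pderiv j u * pderiv j v) - A (euler K d u * euler K d v) := by
  have h1 : ∑ j, pderiv j (pderiv j u * v)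
      = laplace K d u * v + ∑ j, pderiv j u * pderiv j v := by
    simp only [pderiv_mul, Finset.sum_add_distrib, laplace_apply, Finset.sum_mul]
  have h2 : ∑ j, (euler K d (X j * (pderiv j u * v)) + (d + 2 * a) • (X j * (pderiv j u * v)))
      = euler K d (euler K d u * v) + (d + 2 * a) • (euler K d u * v) := by
    rw [Finset.sum_add_distrib, ← map_sum, ← Finset.smul_sum]
    simp only [← mul_assoc, ← Finset.sum_mul, ← euler_apply]
  have h3 : A (∑ j, pderiv j (pderiv j u * v))
      = A (euler K d (euler K d u * v) + (d + 2 * a) • (euler K d u * v)) := by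
    rw [← h2, map_sum, map_sum]
    exact Finset.sum_congr rfl fun j _ => hA.apply_pderiv ha j _
  rw [h1, map_add, map_sum] at h3
  rw [← sub_eq_iff_eq_add'.2 h3.symm]
  rw [← map_sub, ← map_sub]
  congr 1
  rw [ballOp, euler_mul]
  simp only [Algebra.smul_def]
  ring

lemma apply_ballOp (hA : IsBallFunctional a A) (ha : 2 * (a + 1) ≠ 0)
    (u : MvPolynomial (Fin d) K) : A (ballOp (d + 2 * a - 2) u) = -2 * A (euler K d u) := by
  have h := hA.apply_ballOp_mul ha u 1
  simp only [mul_one, Derivation.map_one_eq_zero, mul_zero, map_zero, Finset.sum_const_zero,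
    sub_zero] at h
  have h1 : ballOp (d + 2 * a - 2) u = ballOp (d + 2 * a) u - (2 : K) • euler K d u := by
    simp only [ballOp]; module
  rw [h1, map_sub, h, map_smul, smul_eq_mul]
  ring

end IsBallFunctional

/-! ### The Sobolev form and the perturbed operator -/

/-- The bilinear form `∑ j, A(∂_j p ∂_j q) + A(1)⁻¹ A(p) A(q)`, without complex conjugation. -/
noncomputable def sobolevForm (A : MvPolynomial (Fin d) K →ₗ[K] K)
    (p q : MvPolynomial (Fin d) K) : K :=
  ∑ j, A (pderiv j p * pderiv j q) + (A 1)⁻¹ * A p * A q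

/-- The rank-one perturbation of `-Δ + E² + k E` by twice the mean value of `E p`. -/
noncomputable def ballOpTilde (k : K) (A : MvPolynomial (Fin d) K →ₗ[K] K)
    (p : MvPolynomial (Fin d) K) : MvPolynomial (Fin d) K :=
  ballOp k p + C (2 * ((A 1)⁻¹ * A (euler K d p)))

lemma pderiv_ballOpTilde (k : K) (A : MvPolynomial (Fin d) K →ₗ[K] K) (j : Fin d)
    (p : MvPolynomial (Fin d) K) :
    pderiv j (ballOpTilde k A p) = ballOp (k + 2) (pderiv j p) + (k + 1) • pderiv j p := by
  rw [ballOpTilde, map_add, pderiv_C, add_zero, pderiv_ballOp]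

lemma sobolevForm_sub_smul (A : MvPolynomial (Fin d) K →ₗ[K] K) (c : K)
    (p q r : MvPolynomial (Fin d) K) :
    sobolevForm A (p - c • q) r = sobolevForm A p r - c * sobolevForm A q r := by
  simp only [sobolevForm, map_sub, sub_mul, map_smul, Derivation.map_smul, smul_mul_assoc,
    Finset.sum_sub_distrib, Finset.mul_sum, mul_add, smul_eq_mul]
  ring

lemma totalDegree_ballOpTilde_lt (k : K) (A : MvPolynomial (Fin d) K →ₗ[K] K)
    {p : MvPolynomial (Fin d) K} {n : ℕ} (hp : p.totalDegree < n) :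
    (ballOpTilde k A p).totalDegree < n := by
  refine (totalDegree_add _ _).trans_lt (max_lt (totalDegree_ballOp_lt k hp) ?_)
  rw [totalDegree_C]; omega

lemma totalDegree_ballOpTilde_sub_lt (k : K) (A : MvPolynomial (Fin d) K →ₗ[K] K)
    {p : MvPolynomial (Fin d) K} {n : ℕ} (hn : 0 < n) (hp : p.totalDegree ≤ n) :
    (ballOpTilde k A p - ((n : K) * (n + k)) • p).totalDegree < n := by
  rw [ballOpTilde, add_sub_right_comm]
  refine (totalDegree_add _ _).trans_lt (max_lt (totalDegree_ballOp_sub_lt k hn hp) ?_)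
  rwa [totalDegree_C]

/-- The perturbation by the mean of `E p` is what makes the range orthogonal to the constants. -/
lemma IsBallFunctional.apply_ballOpTilde {a : K} {A : MvPolynomial (Fin d) K →ₗ[K] K}
    (hA : IsBallFunctional a A) (ha : 2 * (a + 1) ≠ 0) (h1 : A 1 ≠ 0)
    (p : MvPolynomial (Fin d) K) : A (ballOpTilde (d + 2 * a - 2) A p) = 0 := by
  have h2 (c : K) : A (C c) = c * A 1 := by
    rw [← smul_eq_mul, ← map_smul, Algebra.smul_def, mul_one, algebraMap_eq]
  rw [ballOpTilde, map_add, hA.apply_ballOp ha, h2]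
  field_simp
  ring

/-- The perturbed operator is symmetric for the Sobolev form: `∂_j` turns `ℒ^{(a-1)}` into
`ℒ^{(a)}` plus a constant, and `ℒ^{(a)}` is symmetric. -/
lemma IsBallFunctional.sobolevForm_ballOpTilde {a : K} {A : MvPolynomial (Fin d) K →ₗ[K] K}
    (hA : IsBallFunctional a A) (ha : 2 * (a + 1) ≠ 0) (h1 : A 1 ≠ 0)
    (p q : MvPolynomial (Fin d) K) :
    sobolevForm A (ballOpTilde (d + 2 * a - 2) A p) q
      = sobolevForm A p (ballOpTilde (d + 2 * a - 2) A q) := by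
  simp only [sobolevForm, hA.apply_ballOpTilde ha h1, pderiv_ballOpTilde, sub_add_cancel]
  simp only [mul_zero, zero_mul, add_zero]
  refine Finset.sum_congr rfl fun j _ => ?_
  have h (u v : MvPolynomial (Fin d) K) :
      A (ballOp (d + 2 * a) u * v) = A (u * ballOp (d + 2 * a) v) := by
    rw [mul_comm u, hA.apply_ballOp_mul ha, hA.apply_ballOp_mul ha, mul_comm (euler K d u)]
    simp only [mul_comm (pderiv _ u)]
  rw [add_mul, mul_add, map_add, map_add, h, smul_mul_assoc, mul_smul_comm]

end Algebra

end BallOP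

namespace BallOP

open MvPolynomial MeasureTheory Metric Filter Topology

/-! ### Polynomial functions and their derivatives -/

section Calculus

variable {𝕜 : Type*} [RCLike 𝕜] {d : ℕ}

lemma polyFun_C (a : 𝕜) (x : EuclideanSpace ℝ (Fin d)) : polyFun (C a) x = a := by
  simp [polyFun]

lemma polyFun_X (i : Fin d) (x : EuclideanSpace ℝ (Fin d)) :
    polyFun (X i : MvPolynomial (Fin d) 𝕜) x = ((x i : ℝ) : 𝕜) := by
  simp [polyFun]

lemma polyFun_add (p q : MvPolynomial (Fin d) 𝕜) (x : EuclideanSpace ℝ (Fin d)) :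
    polyFun (p + q) x = polyFun p x + polyFun q x := by
  simp [polyFun]

lemma polyFun_mul (p q : MvPolynomial (Fin d) 𝕜) (x : EuclideanSpace ℝ (Fin d)) :
    polyFun (p * q) x = polyFun p x * polyFun q x := by
  simp [polyFun]

lemma polyFun_map_conj (p : MvPolynomial (Fin d) 𝕜) (x : EuclideanSpace ℝ (Fin d)) :
    polyFun (map (starRingEnd 𝕜) p) x = starRingEnd 𝕜 (polyFun p x) := by
  induction p using MvPolynomial.induction_on with
  | C a => simp [polyFun_C]
  | add p q hp hq => simp [polyFun_add, hp, hq]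
  | mul_X p i hp => simp [polyFun_mul, polyFun_X, hp]

lemma polyFun_sqNorm (x : EuclideanSpace ℝ (Fin d)) :
    polyFun (sqNorm 𝕜 d) x = ((‖x‖ ^ 2 : ℝ) : 𝕜) := by
  simp [polyFun, sqNorm, EuclideanSpace.norm_sq_eq]

lemma differentiable_polyFun (p : MvPolynomial (Fin d) 𝕜) : Differentiable ℝ (polyFun p) := by
  induction p using MvPolynomial.induction_on with
  | C a =>
    have : (polyFun (C a : MvPolynomial (Fin d) 𝕜)) = fun _ => a := funext (polyFun_C a)
    rw [this]; fun_prop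
  | add p q hp hq =>
    have : polyFun (p + q) = fun x => polyFun p x + polyFun q x := funext (polyFun_add p q)
    rw [this]; fun_prop
  | mul_X p i hp =>
    have : polyFun (p * X i) = fun x => polyFun p x * RCLike.ofRealCLM (x i) := by
      ext x; simp [polyFun_mul, polyFun_X]
    rw [this]; fun_prop

lemma hasLineDerivAt_coord (i j : Fin d) (x : EuclideanSpace ℝ (Fin d)) :
    HasLineDerivAt ℝ (fun y : EuclideanSpace ℝ (Fin d) => y i) (if i = j then 1 else 0) x
      (EuclideanSpace.single j (1 : ℝ)) := by
  have h := ((EuclideanSpace.proj (𝕜 := ℝ) i : EuclideanSpace ℝ (Fin d) →L[ℝ] ℝ).hasFDerivAt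
    (x := x)).hasLineDerivAt (EuclideanSpace.single j (1 : ℝ))
  simpa using h

lemma hasLineDerivAt_polyFun (j : Fin d) (p : MvPolynomial (Fin d) 𝕜)
    (x : EuclideanSpace ℝ (Fin d)) :
    HasLineDerivAt ℝ (polyFun p) (polyFun (pderiv j p) x) x (EuclideanSpace.single j (1 : ℝ)) := by
  induction p using MvPolynomial.induction_on with
  | C a =>
    have : (polyFun (C a : MvPolynomial (Fin d) 𝕜)) = fun _ => a := funext (polyFun_C a)
    rw [this, pderiv_C]
    simpa [polyFun, HasLineDerivAt] using hasDerivAt_const (0 : ℝ) a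
  | add p q hp hq =>
    have : polyFun (p + q) = fun x => polyFun p x + polyFun q x := funext (polyFun_add p q)
    rw [this, map_add, polyFun_add]
    exact HasDerivAt.add hp hq
  | mul_X p i hp =>
    have : polyFun (p * X i) = fun x => polyFun p x * ((x i : ℝ) : 𝕜) := by
      ext x; simp [polyFun_mul, polyFun_X]
    rw [this]
    have h := HasDerivAt.mul hp ((RCLike.ofRealCLM (K := 𝕜)).hasFDerivAt.comp_hasDerivAt (0 : ℝ)
      (hasLineDerivAt_coord i j x))
    refine h.congr_deriv ?_
    rw [pderiv_mul, polyFun_add, polyFun_mul, polyFun_mul, pderiv_X, polyFun_X]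
    by_cases hij : i = j
    · subst hij; simp [polyFun]
    · simp [polyFun, hij]

lemma partialD_polyFun (j : Fin d) (p : MvPolynomial (Fin d) 𝕜) :
    partialD j (polyFun p) = polyFun (pderiv j p) :=
  funext fun x => (hasLineDerivAt_polyFun j p x).lineDeriv

lemma hasLineDerivAt_one_sub_normSq (j : Fin d) (x : EuclideanSpace ℝ (Fin d)) :
    HasLineDerivAt ℝ (fun y : EuclideanSpace ℝ (Fin d) => 1 - ‖y‖ ^ 2) (-(2 * x j)) x
      (EuclideanSpace.single j (1 : ℝ)) := by
  have h := (((hasStrictFDerivAt_norm_sq x).hasFDerivAt.const_sub 1)).hasLineDerivAt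
    (EuclideanSpace.single j (1 : ℝ))
  simpa [EuclideanSpace.inner_single_right] using h

lemma one_sub_normSq_pos {x : EuclideanSpace ℝ (Fin d)} (hx : x ∈ ball 0 1) :
    0 < 1 - ‖x‖ ^ 2 := by
  have : ‖x‖ < 1 := by simpa using hx
  nlinarith [norm_nonneg x]

end Calculus

/-! ### A cutoff of the weight near the sphere -/

section Cutoff

/-- A truncation of `t ↦ t^(α+1)` that vanishes for `t ≤ ε`. For `ε > 0` it is differentiable on the
whole line, which `t^(α+1)`, extended by zero to `t ≤ 0`, is not at `t = 0` when `α ≤ 0`. -/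
noncomputable def cutoff (α ε t : ℝ) : ℝ := t ^ (α - 1) * max (t - ε) 0 ^ 2

/-- The derivative of `cutoff α ε`. -/
noncomputable def cutoffDeriv (α ε t : ℝ) : ℝ :=
  (α - 1) * t ^ (α - 2) * max (t - ε) 0 ^ 2 + 2 * t ^ (α - 1) * max (t - ε) 0

lemma cutoff_of_le {α ε t : ℝ} (h : t ≤ ε) : cutoff α ε t = 0 := by
  simp [cutoff, max_eq_right (sub_nonpos.2 h)]

lemma cutoffDeriv_of_le {α ε t : ℝ} (h : t ≤ ε) : cutoffDeriv α ε t = 0 := by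
  simp [cutoffDeriv, max_eq_right (sub_nonpos.2 h)]

lemma hasDerivAt_sq_max (ε t : ℝ) :
    HasDerivAt (fun s : ℝ => max (s - ε) 0 ^ 2) (2 * max (t - ε) 0) t := by
  rcases lt_trichotomy t ε with h | rfl | h
  · rw [max_eq_right (by linarith)]
    refine (hasDerivAt_const t (0 : ℝ)).congr_of_eventuallyEq ?_ |>.congr_deriv (by simp)
    filter_upwards [eventually_lt_nhds h] with s hs
    simp [max_eq_right (sub_nonpos.2 hs.le)]
  · rw [hasDerivAt_iff_isLittleO]
    simp only [sub_self, max_self, mul_zero, smul_zero, sub_zero, ne_eq, OfNat.ofNat_ne_zero,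
      not_false_eq_true, zero_pow]
    refine Asymptotics.IsBigO.trans_isLittleO (g := fun s => ‖s - t‖ ^ 2) ?_ ?_
    · refine Asymptotics.IsBigO.of_bound 1 (Eventually.of_forall fun s => ?_)
      rw [one_mul, norm_pow, norm_pow, norm_norm]
      gcongr
      rw [Real.norm_eq_abs, Real.norm_eq_abs, abs_of_nonneg (le_max_right _ _)]
      exact max_le (le_abs_self _) (abs_nonneg _)
    · exact Asymptotics.isLittleO_pow_sub_sub t one_lt_two
  · rw [max_eq_left (by linarith)]
    have h1 := ((hasDerivAt_id t).sub_const ε).pow 2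
    refine h1.congr_of_eventuallyEq ?_ |>.congr_deriv (by simp)
    filter_upwards [eventually_gt_nhds h] with s hs
    simp [max_eq_left (sub_nonneg.2 hs.le)]

lemma hasDerivAt_cutoff {ε : ℝ} (hε : 0 < ε) (α t : ℝ) :
    HasDerivAt (cutoff α ε) (cutoffDeriv α ε t) t := by
  rcases lt_or_ge t ε with h | h
  · rw [cutoffDeriv_of_le h.le]
    refine (hasDerivAt_const t (0 : ℝ)).congr_of_eventuallyEq ?_
    filter_upwards [eventually_lt_nhds h] with s hs using cutoff_of_le hs.le
  · have h1 := (Real.hasDerivAt_rpow_const (p := α - 1) (Or.inl (hε.trans_le h).ne')).mul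
      (hasDerivAt_sq_max ε t)
    refine h1.congr_deriv ?_
    rw [cutoffDeriv, show α - 1 - 1 = α - 2 by ring]
    ring

lemma abs_cutoff_le {α ε t : ℝ} (hε : 0 < ε) (ht : 0 < t) (h1 : t ≤ 1) :
    |cutoff α ε t| ≤ t ^ α := by
  have hm : max (t - ε) 0 ≤ t := max_le (by linarith) ht.le
  have hm0 : 0 ≤ max (t - ε) 0 := le_max_right _ _
  rw [cutoff, abs_of_nonneg (by positivity)]
  calc t ^ (α - 1) * max (t - ε) 0 ^ 2 ≤ t ^ (α - 1) * t := by
        gcongr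
        nlinarith
    _ = t ^ α := by rw [← Real.rpow_add_one ht.ne']; ring_nf

lemma abs_cutoffDeriv_le {α ε t : ℝ} (hε : 0 < ε) (ht : 0 < t) :
    |cutoffDeriv α ε t| ≤ (|α - 1| + 2) * t ^ α := by
  have hm : max (t - ε) 0 ≤ t := max_le (by linarith) ht.le
  have hm0 : 0 ≤ max (t - ε) 0 := le_max_right _ _
  have e1 : t ^ α = t ^ (α - 2) * t ^ 2 := by
    rw [← Real.rpow_natCast t 2, ← Real.rpow_add ht]; norm_num
  have e2 : t ^ α = t ^ (α - 1) * t := by rw [← Real.rpow_add_one ht.ne']; ring_nf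
  rw [cutoffDeriv, add_mul]
  refine (abs_add_le _ _).trans (add_le_add ?_ ?_)
  · rw [abs_mul, abs_mul, abs_of_nonneg (by positivity : 0 ≤ t ^ (α - 2)),
      abs_of_nonneg (by positivity : 0 ≤ max (t - ε) 0 ^ 2), e1, mul_assoc]
    gcongr
  · rw [abs_of_nonneg (by positivity), e2, mul_assoc]
    gcongr

lemma tendsto_cutoff {α t : ℝ} (ht : 0 < t) :
    Tendsto (fun ε => cutoff α ε t) (𝓝[>] 0) (𝓝 (t ^ (α + 1))) := by
  have hc : Continuous fun ε => cutoff α ε t := by unfold cutoff; fun_prop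
  have h0 : cutoff α 0 t = t ^ (α + 1) := by
    rw [cutoff, sub_zero, max_eq_left ht.le, ← Real.rpow_natCast t 2, ← Real.rpow_add ht]
    norm_num
    ring_nf
  exact h0 ▸ (hc.tendsto 0).mono_left nhdsWithin_le_nhds

lemma tendsto_cutoffDeriv {α t : ℝ} (ht : 0 < t) :
    Tendsto (fun ε => cutoffDeriv α ε t) (𝓝[>] 0) (𝓝 ((α + 1) * t ^ α)) := by
  have hc : Continuous fun ε => cutoffDeriv α ε t := by unfold cutoffDeriv; fun_prop
  have h0 : cutoffDeriv α 0 t = (α + 1) * t ^ α := by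
    have e1 : t ^ α = t ^ (α - 2) * t ^ 2 := by
      rw [← Real.rpow_natCast t 2, ← Real.rpow_add ht]; norm_num
    have e2 : t ^ α = t ^ (α - 1) * t := by rw [← Real.rpow_add_one ht.ne']; ring_nf
    rw [cutoffDeriv, sub_zero, max_eq_left ht.le, mul_assoc, ← e1, mul_assoc, ← e2]
    ring
  exact h0 ▸ (hc.tendsto 0).mono_left nhdsWithin_le_nhds

lemma measurable_cutoff (α ε : ℝ) : Measurable (cutoff α ε) := by
  unfold cutoff; fun_prop

lemma measurable_cutoffDeriv (α ε : ℝ) : Measurable (cutoffDeriv α ε) := by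
  unfold cutoffDeriv; fun_prop

end Cutoff

/-! ### Integration against the weight -/

section Integration

variable {𝕜 : Type*} [RCLike 𝕜] {d : ℕ} {α : ℝ}

/-- Polar coordinates reduce the claim to `∫₀¹ (1 - y)^α dy < ∞`. -/
lemma integrableOn_weight (hd : 1 ≤ d) (hα : -1 < α) :
    IntegrableOn (weight α) (ball (0 : EuclideanSpace ℝ (Fin d)) 1) := by
  have : Nonempty (Fin d) := ⟨⟨0, hd⟩⟩
  change IntegrableOn (fun x => (fun y : ℝ => (1 - y ^ 2) ^ α) ‖x‖) _ _
  rw [integrableOn_fun_norm_addHaar volume (f := fun y : ℝ => (1 - y ^ 2) ^ α)]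
  have h1 : IntervalIntegrable (fun y : ℝ => (1 - y) ^ α) volume 0 1 := by
    have h := (intervalIntegral.intervalIntegrable_rpow' hα (a := 0) (b := 1)).comp_sub_left 1
    simpa using h.symm
  have h2 : ContinuousOn (fun y : ℝ => y ^ (Module.finrank ℝ (EuclideanSpace ℝ (Fin d)) - 1)
      * (1 + y) ^ α) (Set.uIcc 0 1) := by
    refine ContinuousOn.mul (by fun_prop) (ContinuousOn.rpow_const (by fun_prop) fun y hy => ?_)
    rw [Set.uIcc_of_le zero_le_one] at hy
    exact Or.inl (by linarith [hy.1])
  have h3 := h1.continuousOn_mul h2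
  rw [intervalIntegrable_iff_integrableOn_Ioo_of_le zero_le_one] at h3
  refine h3.congr_fun (fun y hy => ?_) measurableSet_Ioo
  have e : 1 - y ^ 2 = (1 + y) * (1 - y) := by ring
  simp only [smul_eq_mul]
  rw [e, Real.mul_rpow (by linarith [hy.1]) (by linarith [hy.2])]
  ring

lemma exists_norm_polyFun_le (p : MvPolynomial (Fin d) 𝕜) :
    ∃ M, ∀ x ∈ ball (0 : EuclideanSpace ℝ (Fin d)) 1, ‖polyFun p x‖ ≤ M := by
  obtain ⟨M, hM⟩ := (isCompact_closedBall (0 : EuclideanSpace ℝ (Fin d)) 1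
    ).exists_bound_of_continuousOn (differentiable_polyFun p).continuous.continuousOn
  exact ⟨M, fun x hx => hM x (ball_subset_closedBall hx)⟩

lemma norm_smul_polyFun_le {p : MvPolynomial (Fin d) 𝕜} {M c : ℝ}
    (hM : ∀ x ∈ ball (0 : EuclideanSpace ℝ (Fin d)) 1, ‖polyFun p x‖ ≤ M)
    {F : EuclideanSpace ℝ (Fin d) → ℝ}
    (hF : ∀ x, |F x| ≤ c * (ball 0 1).indicator (weight α) x) (x : EuclideanSpace ℝ (Fin d)) :
    ‖F x • polyFun p x‖ ≤ c * (ball 0 1).indicator (weight α) x * M := by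
  rw [norm_smul, Real.norm_eq_abs]
  by_cases hx : x ∈ ball (0 : EuclideanSpace ℝ (Fin d)) 1
  · exact mul_le_mul (hF x) (hM x hx) (norm_nonneg _) ((abs_nonneg _).trans (hF x))
  · have := hF x
    rw [Set.indicator_of_notMem hx, mul_zero] at this ⊢
    rw [abs_nonpos_iff.1 this]; simp

lemma integrable_bound (hd : 1 ≤ d) (hα : -1 < α) (c M : ℝ) :
    Integrable fun x : EuclideanSpace ℝ (Fin d) =>
      c * (ball 0 1).indicator (weight α) x * M :=
  (((integrable_indicator_iff measurableSet_ball).2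
    (integrableOn_weight hd hα)).const_mul c).mul_const M

lemma integrable_smul_polyFun (hd : 1 ≤ d) (hα : -1 < α) (p : MvPolynomial (Fin d) 𝕜)
    {F : EuclideanSpace ℝ (Fin d) → ℝ} {c : ℝ} (hm : Measurable F)
    (hF : ∀ x, |F x| ≤ c * (ball 0 1).indicator (weight α) x) :
    Integrable fun x => F x • polyFun p x := by
  obtain ⟨M, hM⟩ := exists_norm_polyFun_le p
  exact (integrable_bound hd hα c M).mono'
    (hm.aestronglyMeasurable.smul (differentiable_polyFun p).continuous.aestronglyMeasurable)
    (Eventually.of_forall (norm_smul_polyFun_le hM hF))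

lemma measurable_weight : Measurable (weight α : EuclideanSpace ℝ (Fin d) → ℝ) := by
  unfold weight; fun_prop

lemma weight_nonneg {x : EuclideanSpace ℝ (Fin d)} (hx : x ∈ ball 0 1) : 0 ≤ weight α x :=
  Real.rpow_nonneg (one_sub_normSq_pos hx).le _

lemma integrableOn_weight_smul_polyFun (hd : 1 ≤ d) (hα : -1 < α) (p : MvPolynomial (Fin d) 𝕜) :
    IntegrableOn (fun x => weight α x • polyFun p x) (ball 0 1) := by
  rw [← integrable_indicator_iff measurableSet_ball]
  simp only [Set.indicator_smul_left]
  refine integrable_smul_polyFun hd hα p (c := 1) (measurable_weight.indicator measurableSet_ball)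
    fun x => ?_
  rw [one_mul, abs_of_nonneg]
  exact Set.indicator_nonneg (fun y hy => weight_nonneg hy) x

/-- Dominated convergence as the cutoff is removed. -/
lemma tendsto_integral_smul_polyFun (hd : 1 ≤ d) (hα : -1 < α) (p : MvPolynomial (Fin d) 𝕜)
    {F : ℝ → EuclideanSpace ℝ (Fin d) → ℝ} {G : EuclideanSpace ℝ (Fin d) → ℝ} {c : ℝ}
    (hm : ∀ ε, Measurable (F ε))
    (hF : ∀ ε > 0, ∀ x, |F ε x| ≤ c * (ball 0 1).indicator (weight α) x)
    (hG : ∀ x ∈ ball 0 1, Tendsto (F · x) (𝓝[>] 0) (𝓝 (G x))) :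
    Tendsto (fun ε => ∫ x, F ε x • polyFun p x) (𝓝[>] 0)
      (𝓝 (∫ x in ball 0 1, G x • polyFun p x)) := by
  obtain ⟨M, hM⟩ := exists_norm_polyFun_le p
  rw [← integral_indicator measurableSet_ball]
  refine tendsto_integral_filter_of_dominated_convergence _
    (Eventually.of_forall fun ε => (hm ε).aestronglyMeasurable.smul
      (differentiable_polyFun p).continuous.aestronglyMeasurable)
    ?_ (integrable_bound hd hα c M) (Eventually.of_forall fun x => ?_)
  · filter_upwards [self_mem_nhdsWithin] with ε hε
    exact Eventually.of_forall (norm_smul_polyFun_le hM (hF ε hε))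
  · rw [Set.indicator_smul_left]
    refine Tendsto.smul_const ?_ _
    by_cases hx : x ∈ ball (0 : EuclideanSpace ℝ (Fin d)) 1
    · rw [Set.indicator_of_mem hx]; exact hG x hx
    · rw [Set.indicator_of_notMem hx]
      refine tendsto_const_nhds.congr' ?_
      filter_upwards [self_mem_nhdsWithin] with ε hε
      have := hF ε hε x
      rw [Set.indicator_of_notMem hx, mul_zero] at this
      exact (abs_nonpos_iff.1 this).symm

lemma abs_comp_one_sub_normSq_le {f : ℝ → ℝ} {c : ℝ} (h0 : ∀ t ≤ 0, f t = 0)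
    (h : ∀ t, 0 < t → t ≤ 1 → |f t| ≤ c * t ^ α) (x : EuclideanSpace ℝ (Fin d)) :
    |f (1 - ‖x‖ ^ 2)| ≤ c * (ball 0 1).indicator (weight α) x := by
  by_cases hx : x ∈ ball (0 : EuclideanSpace ℝ (Fin d)) 1
  · rw [Set.indicator_of_mem hx]
    exact h _ (one_sub_normSq_pos hx) (by nlinarith [norm_nonneg x])
  · rw [Set.indicator_of_notMem hx, h0]
    · simp
    · have : 1 ≤ ‖x‖ := by simpa using hx
      nlinarith

/-- Integration by parts, `∫ ∂_j p W_{α+1} = 2 (α + 1) ∫ x_j p W_α`. There is no boundary term since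
`W_{α+1}` vanishes on the sphere; as it need not be differentiable there, the formula is proved for
the cutoffs of `W_{α+1}` first. -/
lemma integral_weight_smul_pderiv (hd : 1 ≤ d) (hα : -1 < α) (j : Fin d)
    (p : MvPolynomial (Fin d) 𝕜) :
    ∫ x in ball 0 1, weight (α + 1) x • polyFun (pderiv j p) x
      = (2 * (α + 1)) • ∫ x in ball 0 1, weight α x • polyFun (X j * p) x := by
  have b1 : ∀ ε > 0, ∀ x : EuclideanSpace ℝ (Fin d),
      |cutoff α ε (1 - ‖x‖ ^ 2)| ≤ 1 * (ball 0 1).indicator (weight α) x := fun ε hε =>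
    abs_comp_one_sub_normSq_le (fun t ht => cutoff_of_le (ht.trans hε.le))
      fun t ht h1 => by rw [one_mul]; exact abs_cutoff_le hε ht h1
  have b2 : ∀ ε > 0, ∀ x : EuclideanSpace ℝ (Fin d),
      |cutoffDeriv α ε (1 - ‖x‖ ^ 2)| ≤ (|α - 1| + 2) * (ball 0 1).indicator (weight α) x :=
    fun ε hε => abs_comp_one_sub_normSq_le (fun t ht => cutoffDeriv_of_le (ht.trans hε.le))
      fun t ht _ => abs_cutoffDeriv_le hε ht
  have m0 : Measurable fun x : EuclideanSpace ℝ (Fin d) => 1 - ‖x‖ ^ 2 := by fun_prop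
  have m1 (ε : ℝ) := (measurable_cutoff α ε).comp m0
  have m2 (ε : ℝ) := (measurable_cutoffDeriv α ε).comp m0
  have l1 := tendsto_integral_smul_polyFun hd hα (pderiv j p) m1 b1
    (G := weight (α + 1)) fun x hx => tendsto_cutoff (one_sub_normSq_pos hx)
  have l2 := (tendsto_integral_smul_polyFun hd hα (X j * p) m2 b2
    (G := fun x => (α + 1) * weight α x)
    fun x hx => tendsto_cutoffDeriv (one_sub_normSq_pos hx)).const_smul (2 : ℝ)
  have key : ∀ ε > 0, ∫ x : EuclideanSpace ℝ (Fin d),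
        cutoff α ε (1 - ‖x‖ ^ 2) • polyFun (pderiv j p) x
      = (2 : ℝ) • ∫ x : EuclideanSpace ℝ (Fin d),
        cutoffDeriv α ε (1 - ‖x‖ ^ 2) • polyFun (X j * p) x := by
    intro ε hε
    have e (x : EuclideanSpace ℝ (Fin d)) :
        (cutoffDeriv α ε (1 - ‖x‖ ^ 2) * -(2 * x j)) • polyFun p x
          = (-2 : ℝ) • (cutoffDeriv α ε (1 - ‖x‖ ^ 2) • polyFun (X j * p) x) := by
      rw [polyFun_mul, polyFun_X]
      simp only [RCLike.real_smul_eq_coe_mul]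
      push_cast
      ring
    have ibp := integral_bilinear_hasLineDerivAt_right_eq_neg_left_of_integrable
      (μ := volume) (B := ContinuousLinearMap.lsmul ℝ ℝ)
      (f := fun x : EuclideanSpace ℝ (Fin d) => cutoff α ε (1 - ‖x‖ ^ 2))
      (f' := fun x => cutoffDeriv α ε (1 - ‖x‖ ^ 2) * -(2 * x j))
      (g := polyFun p) (g' := polyFun (pderiv j p)) (v := EuclideanSpace.single j (1 : ℝ))
      ?_ (integrable_smul_polyFun hd hα _ (m1 ε) (b1 ε hε))
      (integrable_smul_polyFun hd hα _ (m1 ε) (b1 ε hε))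
      (fun x _ => ?_) (fun x _ => hasLineDerivAt_polyFun j p x)
    · simp only [ContinuousLinearMap.lsmul_apply, e, integral_smul] at ibp
      rw [ibp, neg_smul, neg_neg]
    · simp only [ContinuousLinearMap.lsmul_apply, e]
      exact (integrable_smul_polyFun hd hα _ (m2 ε) (b2 ε hε)).smul (-2 : ℝ)
    · have h1 := hasDerivAt_cutoff hε α (1 - ‖x + (0 : ℝ) • EuclideanSpace.single j (1 : ℝ)‖ ^ 2)
      have h2 := h1.comp (0 : ℝ) (hasLineDerivAt_one_sub_normSq j x)
      simpa [HasLineDerivAt, Function.comp_def] using h2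
  have := tendsto_nhds_unique_of_eventuallyEq l1 l2 (by
    filter_upwards [self_mem_nhdsWithin] with ε hε using key ε hε)
  rw [this]
  simp only [mul_smul, integral_smul]

/-- Integration of polynomials against `W_α` over the unit ball, as a linear functional. -/
noncomputable def ballIntegral (𝕜 : Type*) [RCLike 𝕜] (hd : 1 ≤ d) (hα : -1 < α) :
    MvPolynomial (Fin d) 𝕜 →ₗ[𝕜] 𝕜 where
  toFun p := ∫ x in ball 0 1, weight α x • polyFun p x
  map_add' p q := by
    rw [← integral_add (integrableOn_weight_smul_polyFun hd hα p)
      (integrableOn_weight_smul_polyFun hd hα q)]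
    simp only [polyFun_add, smul_add]
  map_smul' c p := by
    rw [RingHom.id_apply, ← integral_smul]
    simp only [Algebra.smul_def c p, algebraMap_eq, polyFun_mul, polyFun_C, smul_eq_mul,
      mul_smul_comm]

lemma isBallFunctional_ballIntegral (hd : 1 ≤ d) (hα : -1 < α) :
    IsBallFunctional (α : 𝕜) (ballIntegral 𝕜 hd hα) := by
  intro j g
  have h := integral_weight_smul_pderiv hd hα j g
  rw [RCLike.real_smul_eq_coe_mul] at h
  push_cast at h
  refine Eq.trans ?_ h
  refine setIntegral_congr_fun measurableSet_ball fun x hx => ?_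
  have e : polyFun ((1 - sqNorm 𝕜 d) * pderiv j g) x
      = (1 - ‖x‖ ^ 2 : ℝ) • polyFun (pderiv j g) x := by
    rw [polyFun_mul, RCLike.real_smul_eq_coe_mul, RCLike.ofReal_sub, ← polyFun_sqNorm]
    simp [polyFun]
  simp only [e, smul_smul, weight]
  rw [Real.rpow_add_one (one_sub_normSq_pos hx).ne']

lemma innerL2_polyFun (hd : 1 ≤ d) (hα : -1 < α) (p q : MvPolynomial (Fin d) 𝕜) :
    innerL2 α (polyFun p) (polyFun q)
      = ballIntegral 𝕜 hd hα (p * map (starRingEnd 𝕜) q) := by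
  refine integral_congr_ae (Eventually.of_forall fun x => ?_)
  simp only [polyFun_mul, polyFun_map_conj, RCLike.real_smul_eq_coe_mul]
  ring

lemma innerL2_self (p : MvPolynomial (Fin d) 𝕜) :
    innerL2 α (polyFun p) (polyFun p)
      = ((∫ x in ball 0 1, ‖polyFun p x‖ ^ 2 * weight α x : ℝ) : 𝕜) := by
  rw [← integral_ofReal]
  refine integral_congr_ae (Eventually.of_forall fun x => ?_)
  simp only [RCLike.mul_conj]
  push_cast
  rfl

lemma integral_normSq_nonneg (p : MvPolynomial (Fin d) 𝕜) :
    0 ≤ ∫ x in ball 0 1, ‖polyFun p x‖ ^ 2 * weight α x :=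
  setIntegral_nonneg measurableSet_ball fun _ hx => mul_nonneg (sq_nonneg _) (weight_nonneg hx)

lemma polyFun_eq_zero_of_integral_normSq (hd : 1 ≤ d) (hα : -1 < α) {p : MvPolynomial (Fin d) 𝕜}
    (h : ∫ x in ball 0 1, ‖polyFun p x‖ ^ 2 * weight α x = 0) :
    ∀ x ∈ ball 0 1, polyFun p x = 0 := by
  have hi : IntegrableOn (fun x => ‖polyFun p x‖ ^ 2 * weight α x) (ball 0 1) := by
    have hn : IntegrableOn (fun x => ‖weight α x • polyFun (p * map (starRingEnd 𝕜) p) x‖)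
        (ball 0 1) := (integrableOn_weight_smul_polyFun hd hα
          (p * map (starRingEnd 𝕜) p)).norm
    refine hn.congr_fun (fun x hx => ?_) measurableSet_ball
    simp only [polyFun_mul, polyFun_map_conj, norm_smul, norm_mul, RCLike.norm_conj]
    rw [Real.norm_of_nonneg (weight_nonneg hx)]
    ring
  rw [setIntegral_eq_zero_iff_of_nonneg_ae ?_ hi] at h
  · refine Measure.eqOn_open_of_ae_eq (μ := volume) (g := fun _ => (0 : 𝕜)) ?_ isOpen_ball
      (differentiable_polyFun p).continuous.continuousOn continuousOn_const
    filter_upwards [h, ae_restrict_mem measurableSet_ball] with x hx hb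
    have hw : weight α x ≠ 0 := (Real.rpow_pos_of_pos (one_sub_normSq_pos hb) _).ne'
    simpa [hw] using hx
  · filter_upwards [ae_restrict_mem measurableSet_ball] with x hb
    exact mul_nonneg (sq_nonneg _) (weight_nonneg hb)

lemma ballIntegral_one_ne_zero (hd : 1 ≤ d) (hα : -1 < α) : ballIntegral 𝕜 hd hα 1 ≠ 0 := by
  intro h
  have h1 := innerL2_polyFun hd hα (1 : MvPolynomial (Fin d) 𝕜) 1
  rw [map_one, mul_one, h, innerL2_self, RCLike.ofReal_eq_zero] at h1
  have := polyFun_eq_zero_of_integral_normSq hd hα h1 0 (by simp)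
  simp [polyFun] at this

end Integration

end BallOP

namespace BallOP

open MvPolynomial MeasureTheory Metric Filter Topology

/-! ### The angular part of the operator -/

section Operators

variable {K : Type*} [Field K] {d : ℕ}

/-- The angular derivative `x_i ∂_j - x_j ∂_i` on polynomials. -/
noncomputable def angular (i j : Fin d) (p : MvPolynomial (Fin d) K) : MvPolynomial (Fin d) K :=
  X i * pderiv j p - X j * pderiv i p

lemma sum_sum_angular_angular (p : MvPolynomial (Fin d) K) :
    ∑ i, ∑ j, angular i j (angular i j p)
      = 2 * (sqNorm K d * laplace K d p - euler K d (euler K d p)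
          + (2 - (d : MvPolynomial (Fin d) K)) * euler K d p) := by
  -- The last term makes the formula valid on the diagonal, where the left-hand side is zero.
  have h (i j : Fin d) : angular i j (angular i j p)
      = (X i ^ 2 * pderiv j (pderiv j p) + X j ^ 2 * pderiv i (pderiv i p))
        - 2 * (X i * (X j * pderiv j (pderiv i p))) - (X i * pderiv i p + X j * pderiv j p)
        + 2 * (if i = j then X i * pderiv i p else 0) := by
    by_cases hij : i = j
    · subst hij; simp [angular]; ring
    · simp only [angular, map_sub, pderiv_mul, pderiv_X_self, pderiv_X_of_ne hij,
        pderiv_X_of_ne (Ne.symm hij), if_neg hij, pderiv_comm i j]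
      ring
  have e1 : ∑ i : Fin d, ∑ j, X i ^ 2 * pderiv j (pderiv j p) = sqNorm K d * laplace K d p := by
    rw [sqNorm, laplace_apply, Finset.sum_mul_sum]
  have e2 : ∑ i : Fin d, ∑ j, X j ^ 2 * pderiv i (pderiv i p) = sqNorm K d * laplace K d p := by
    rw [Finset.sum_comm, e1]
  have e3 : ∑ i : Fin d, ∑ j, 2 * (X i * (X j * pderiv j (pderiv i p)))
      = 2 * (euler K d (euler K d p) - euler K d p) := by
    rw [euler_apply (euler K d p)]
    simp only [pderiv_euler, mul_add, Finset.sum_add_distrib, ← euler_apply, ← Finset.mul_sum]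
    ring
  have e4 : ∑ i : Fin d, ∑ _j : Fin d, X i * pderiv i p = d * euler K d p := by
    simp [euler_apply, Finset.mul_sum]
  have e5 : ∑ _i : Fin d, ∑ j : Fin d, X j * pderiv j p = d * euler K d p := by
    simp [euler_apply]
  have e6 : ∑ i : Fin d, ∑ j, 2 * (if i = j then X i * pderiv i p else 0)
      = 2 * euler K d p := by
    simp only [← Finset.mul_sum, Finset.sum_ite_eq, Finset.mem_univ, if_true, ← euler_apply]
  simp only [h, Finset.sum_add_distrib, Finset.sum_sub_distrib, e1, e2, e3, e4, e5, e6]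
  ring

/-- The Casimir identity `∑_{i<j} D_{i,j}² = r² Δ - E² - (d - 2) E`. -/
lemma sum_Ioi_angular_angular [NeZero (2 : K)] (p : MvPolynomial (Fin d) K) :
    ∑ i, ∑ j ∈ Finset.Ioi i, angular i j (angular i j p)
      = sqNorm K d * laplace K d p - euler K d (euler K d p)
          + (2 - (d : MvPolynomial (Fin d) K)) * euler K d p := by
  have hs (i j : Fin d) : angular j i (angular j i p) = angular i j (angular i j p) := by
    simp only [angular, map_sub, pderiv_mul]; ring
  have hd (i : Fin d) : angular i i (angular i i p) = 0 := by simp [angular]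
  have h1 (i : Fin d) : ∑ j, angular i j (angular i j p)
      = ∑ j ∈ Finset.Ioi i, angular i j (angular i j p)
        + ∑ j ∈ Finset.Iio i, angular i j (angular i j p) := by
    rw [← Finset.sum_filter_add_sum_filter_not Finset.univ (fun j => i < j)]
    congr 1
    · congr 1; ext j; simp
    · symm
      refine Finset.sum_subset (fun j => by simpa using le_of_lt) fun j hj hj' => ?_
      have : j = i := le_antisymm (by simpa using hj) (by simpa using hj')
      rw [this, hd]
  have h2 : ∑ i, ∑ j ∈ Finset.Iio i, angular i j (angular i j p)
      = ∑ i, ∑ j ∈ Finset.Ioi i, angular i j (angular i j p) := by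
    rw [Finset.sum_comm' (t' := Finset.univ) (s' := fun j => Finset.Ioi j) (by simp)]
    simp only [hs]
  have h3 := sum_sum_angular_angular p
  simp only [h1, Finset.sum_add_distrib, h2] at h3
  rw [← two_mul] at h3
  have h4 : (2 : MvPolynomial (Fin d) K) ≠ 0 := by
    rw [show (2 : MvPolynomial (Fin d) K) = C 2 from (map_ofNat C 2).symm, Ne, C_eq_zero]
    exact two_ne_zero
  exact mul_left_cancel₀ h4 h3

end Operators

/-! ### The operators and inner products of the ball on polynomials -/

section Theorem

variable {𝕜 : Type*} [RCLike 𝕜] {d : ℕ} {α : ℝ}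

lemma angularD_polyFun (i j : Fin d) (p : MvPolynomial (Fin d) 𝕜) :
    angularD i j (polyFun p) = polyFun (angular i j p) := by
  ext x
  simp only [angularD, partialD_polyFun, angular]
  simp [polyFun]

lemma radialD_polyFun (p : MvPolynomial (Fin d) 𝕜) :
    radialD (polyFun p) = polyFun (euler 𝕜 d p) := by
  ext x
  simp only [radialD, partialD_polyFun, euler_apply]
  simp [polyFun]

/-- The power of `1 - ‖x‖²` lowered by differentiating `W_α` is pulled out as `W_{α-1}`. -/
lemma partialD_weight_mul_polyFun (j : Fin d) (p : MvPolynomial (Fin d) 𝕜)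
    {x : EuclideanSpace ℝ (Fin d)} (hx : x ∈ ball 0 1) :
    partialD j (fun y => ((weight α y : ℝ) : 𝕜) * polyFun p y) x
      = ((weight (α - 1) x : ℝ) : 𝕜)
        * (polyFun ((1 - sqNorm 𝕜 d) * pderiv j p - (2 * α : 𝕜) • (X j * p)) x) := by
  have hx0 := one_sub_normSq_pos hx
  have h1 : HasDerivAt (fun t : ℝ => t ^ α) (α * (1 - ‖x‖ ^ 2) ^ (α - 1))
      (1 - ‖x + (0 : ℝ) • EuclideanSpace.single j (1 : ℝ)‖ ^ 2) := by
    simpa using Real.hasDerivAt_rpow_const (p := α) (Or.inl hx0.ne')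
  have h2 := h1.comp (0 : ℝ) (hasLineDerivAt_one_sub_normSq j x)
  have h3 := ((RCLike.ofRealCLM (K := 𝕜)).hasFDerivAt.comp_hasDerivAt (0 : ℝ) h2).mul
    (hasLineDerivAt_polyFun j p x)
  have h4 : HasLineDerivAt ℝ (fun y => ((weight α y : ℝ) : 𝕜) * polyFun p y) _ x
    (EuclideanSpace.single j (1 : ℝ)) := h3
  rw [partialD, h4.lineDeriv]
  have h5 : weight α x = weight (α - 1) x * (1 - ‖x‖ ^ 2) := by
    rw [weight, weight, ← Real.rpow_add_one hx0.ne', sub_add_cancel]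
  have h6 : polyFun ((1 - sqNorm 𝕜 d) * pderiv j p - (2 * α : 𝕜) • (X j * p)) x
      = ((1 - ‖x‖ ^ 2 : ℝ) : 𝕜) * polyFun (pderiv j p) x
        - 2 * α * (((x j : ℝ) : 𝕜) * polyFun p x) := by
    rw [RCLike.ofReal_sub, ← polyFun_sqNorm]
    simp [polyFun, smul_eval]
  rw [h6]
  simp only [Function.comp_apply, zero_smul, add_zero, RCLike.ofRealCLM_apply]
  change _ + ((weight α x : ℝ) : 𝕜) * _ = _
  rw [h5]
  simp only [weight]
  push_cast
  ring

/-- `ℒ^{(α-1)}` is `-Δ + E² + (d + 2 α - 2) E` on polynomials: the `r² Δ` of the weighted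
part cancels against that of the angular part. -/
lemma opL_polyFun (p : MvPolynomial (Fin d) 𝕜) {x : EuclideanSpace ℝ (Fin d)}
    (hx : x ∈ ball 0 1) :
    opL (α - 1) (polyFun p) x = polyFun (ballOp (d + 2 * (α : 𝕜) - 2) p) x := by
  have hw : ((weight (α - 1) x : ℝ) : 𝕜) ≠ 0 := by
    rw [Ne, RCLike.ofReal_eq_zero]
    exact (Real.rpow_pos_of_pos (one_sub_normSq_pos hx) _).ne'
  have hsum (f : Fin d → MvPolynomial (Fin d) 𝕜) (s : Finset (Fin d)) :
      ∑ j ∈ s, polyFun (f j) x = polyFun (∑ j ∈ s, f j) x := by simp [polyFun]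
  have h1 : ∑ j, ((1 - sqNorm 𝕜 d) * pderiv j (pderiv j p) - (2 * α : 𝕜) • (X j * pderiv j p))
      = (1 - sqNorm 𝕜 d) * laplace 𝕜 d p - (2 * α : 𝕜) • euler 𝕜 d p := by
    rw [Finset.sum_sub_distrib, ← Finset.mul_sum, ← Finset.smul_sum, laplace_apply, euler_apply]
  simp only [opL, sub_add_cancel, partialD_polyFun, angularD_polyFun,
    partialD_weight_mul_polyFun _ _ hx, ← Finset.mul_sum, hsum, h1, sum_Ioi_angular_angular]
  rw [RCLike.ofReal_inv, neg_mul, inv_mul_cancel_left₀ hw]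
  simp only [ballOp, polyFun, map_sub, map_add, map_mul, map_neg, smul_eval, map_natCast, map_one,
    map_ofNat]
  ring

/-- The projection onto the constants is the mean value. -/
lemma projL2_zero_polyFun (hd : 1 ≤ d) (hα : -1 < α) (g : MvPolynomial (Fin d) 𝕜) :
    projL2 α 0 (polyFun g)
      = polyFun (C ((ballIntegral 𝕜 hd hα 1)⁻¹ * ballIntegral 𝕜 hd hα g)) := by
  set A := ballIntegral 𝕜 hd hα with hA
  have h1 : A 1 ≠ 0 := ballIntegral_one_ne_zero hd hα
  have hC (c : 𝕜) : A (C c) = c * A 1 := by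
    rw [← smul_eq_mul, ← map_smul, Algebra.smul_def, mul_one, algebraMap_eq]
  have hi (c : 𝕜) (q : MvPolynomial (Fin d) 𝕜) :
      innerL2 α (fun x => polyFun g x - polyFun (C c) x) (polyFun q)
        = A ((g - C c) * map (starRingEnd 𝕜) q) := by
    rw [hA, ← innerL2_polyFun]
    congr 1; ext x; simp [polyFun]
  have hex : ∃ p, IsProjL2 α 0 (polyFun g) p := by
    refine ⟨C ((A 1)⁻¹ * A g), ⟨(totalDegree_C _).le, by simp⟩, fun q hq => ?_⟩
    obtain ⟨b, rfl⟩ : ∃ b, q = C b := ⟨_, totalDegree_eq_zero_iff_eq_C.1 (Nat.le_zero.1 hq.1)⟩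
    rw [hi, map_C, mul_comm, ← smul_eq_C_mul, map_smul, map_sub, hC]
    field_simp
    simp
  obtain ⟨hp, hpo⟩ := Classical.epsilon_spec hex
  rw [projL2]
  generalize Classical.epsilon (IsProjL2 α 0 (polyFun g)) = p at hp hpo
  obtain ⟨c, rfl⟩ : ∃ c, p = C c := ⟨_, totalDegree_eq_zero_iff_eq_C.1 (Nat.le_zero.1 hp.1)⟩
  have h := hpo 1 ⟨by simp, by simp⟩
  rw [hi, map_one, mul_one, map_sub, hC, sub_eq_zero] at h
  rw [h]
  field_simp

lemma opTildeL_polyFun (hd : 1 ≤ d) (hα : -1 < α) (p : MvPolynomial (Fin d) 𝕜)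
    {x : EuclideanSpace ℝ (Fin d)} (hx : x ∈ ball 0 1) :
    opTildeL α (polyFun p) x
      = polyFun (ballOpTilde (d + 2 * (α : 𝕜) - 2) (ballIntegral 𝕜 hd hα) p) x := by
  rw [opTildeL, opL_polyFun p hx, radialD_polyFun, projL2_zero_polyFun hd hα, ballOpTilde,
    polyFun_add, polyFun_C, polyFun_C]

lemma ballIntegral_map_conj (hd : 1 ≤ d) (hα : -1 < α) (p : MvPolynomial (Fin d) 𝕜) :
    ballIntegral 𝕜 hd hα (map (starRingEnd 𝕜) p) = starRingEnd 𝕜 (ballIntegral 𝕜 hd hα p) := by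
  change _ = starRingEnd 𝕜 (∫ x in _, _)
  rw [← integral_conj]
  refine integral_congr_ae (Eventually.of_forall fun x => ?_)
  simp only [polyFun_map_conj, RCLike.real_smul_eq_coe_mul, map_mul, RCLike.conj_ofReal]

lemma innerH1_polyFun (hd : 1 ≤ d) (hα : -1 < α) (p q : MvPolynomial (Fin d) 𝕜) :
    innerH1 α (polyFun p) (polyFun q)
      = sobolevForm (ballIntegral 𝕜 hd hα) p (map (starRingEnd 𝕜) q) := by
  have h1 : (fun _ : EuclideanSpace ℝ (Fin d) => (1 : 𝕜)) = polyFun 1 := by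
    ext x; simp [polyFun]
  simp only [innerH1, h1, partialD_polyFun, innerL2_polyFun hd hα, sobolevForm, map_one, mul_one,
    pderiv_map, ballIntegral_map_conj]

/-- The Sobolev inner product is definite on the unit ball. -/
lemma polyFun_eq_zero_of_innerH1_self (hd : 1 ≤ d) (hα : -1 < α) {f : MvPolynomial (Fin d) 𝕜}
    (h : innerH1 α (polyFun f) (polyFun f) = 0) : ∀ x ∈ ball 0 1, polyFun f x = 0 := by
  set I : MvPolynomial (Fin d) 𝕜 → ℝ := fun g => ∫ x in ball 0 1, ‖polyFun g x‖ ^ 2 * weight α x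
  have hI (g) : 0 ≤ I g := integral_normSq_nonneg g
  have h1 : (fun _ : EuclideanSpace ℝ (Fin d) => (1 : 𝕜)) = polyFun 1 := by
    ext x; simp [polyFun]
  have hI1 : I 1 ≠ 0 := fun h0 => by
    have := polyFun_eq_zero_of_integral_normSq hd hα h0 0 (by simp)
    simp [polyFun] at this
  set z := innerL2 α (polyFun f) (polyFun 1)
  -- All terms of `⟨f, f⟩_{α,1}` are nonnegative reals, so they vanish one by one.
  have h2 : innerH1 α (polyFun f) (polyFun f)
      = ((∑ j, I (pderiv j f) + (I 1)⁻¹ * ‖z‖ ^ 2 : ℝ) : 𝕜) := by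
    simp only [innerH1, h1, partialD_polyFun, innerL2_self]
    rw [mul_assoc, RCLike.mul_conj]
    push_cast
    rfl
  rw [h2, RCLike.ofReal_eq_zero, add_eq_zero_iff_of_nonneg
    (Finset.sum_nonneg fun j _ => hI _) (mul_nonneg (inv_nonneg.2 (hI 1)) (sq_nonneg _)),
    Finset.sum_eq_zero_iff_of_nonneg fun j _ => hI _] at h
  obtain ⟨hgrad, hmean⟩ := h
  have hz : z = 0 := by simpa [hI1] using hmean
  have hpart (j : Fin d) : ∀ x ∈ ball 0 1, polyFun (pderiv j f) x = 0 :=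
    polyFun_eq_zero_of_integral_normSq hd hα (hgrad j (Finset.mem_univ j))
  have hconst : ∃ a, ∀ x ∈ ball 0 1, polyFun f x = a := by
    refine isOpen_ball.exists_is_const_of_fderiv_eq_zero (𝕜 := ℝ)
      (convex_ball 0 1).isPreconnected (differentiable_polyFun f).differentiableOn fun x hx => ?_
    refine ContinuousLinearMap.coe_injective
      ((EuclideanSpace.basisFun (Fin d) ℝ).toBasis.ext fun j => ?_)
    have := ((differentiable_polyFun f) x).lineDeriv_eq_fderiv
      (v := EuclideanSpace.single j (1 : ℝ))
    rw [(hasLineDerivAt_polyFun j f x).lineDeriv, hpart j x hx] at this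
    simpa using this.symm
  obtain ⟨a, ha⟩ := hconst
  have h3 : z = a * (I 1 : 𝕜) := by
    change innerL2 α (polyFun f) (polyFun 1) = a * ((∫ x in _, _ : ℝ) : 𝕜)
    rw [← innerL2_self, innerL2, innerL2, ← integral_const_mul]
    refine setIntegral_congr_fun measurableSet_ball fun x hx => ?_
    simp only [ha x hx]
    simp [polyFun]
  have ha0 : a = 0 := by
    rw [hz] at h3
    simpa [hI1] using h3.symm
  intro x hx
  rw [ha x hx, ha0]

lemma totalDegree_map_conj_le (p : MvPolynomial (Fin d) 𝕜) :
    (map (starRingEnd 𝕜) p).totalDegree ≤ p.totalDegree :=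
  totalDegree_le_of_support_subset (support_map_subset _ _)

lemma map_conj_map_conj (p : MvPolynomial (Fin d) 𝕜) :
    map (starRingEnd 𝕜) (map (starRingEnd 𝕜) p) = p := by
  rw [MvPolynomial.map_map, show (starRingEnd 𝕜).comp (starRingEnd 𝕜) = RingHom.id 𝕜 by ext; simp,
    MvPolynomial.map_id]

end Theorem

end BallOP

open BallOP MvPolynomial in
theorem mainTheorem6 {𝕜 : Type*} [RCLike 𝕜] (d : ℕ) (hd : 1 ≤ d) (α : ℝ) (hα : -1 < α) (n : ℕ)
    (p : MvPolynomial (Fin d) 𝕜) (hp : p ∈ BallOP.orthoH1 𝕜 d α n) :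
    ∀ x ∈ Metric.ball (0 : EuclideanSpace ℝ (Fin d)) 1,
      BallOP.opTildeL α (BallOP.polyFun p) x
        = (((n : ℝ) * ((n : ℝ) + (d : ℝ) + 2 * α - 2) : ℝ) : 𝕜) * BallOP.polyFun p x := by
  obtain ⟨hdeg, horth⟩ := hp
  intro x hx
  rw [opTildeL_polyFun hd hα p hx]
  set A := ballIntegral 𝕜 hd hα
  have hA : IsBallFunctional (α : 𝕜) A := isBallFunctional_ballIntegral hd hα
  have hA1 : A 1 ≠ 0 := ballIntegral_one_ne_zero hd hα
  have ha : 2 * ((α : 𝕜) + 1) ≠ 0 := by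
    have : 2 * (α + 1) ≠ 0 := by linarith
    exact_mod_cast (RCLike.ofReal_ne_zero (K := 𝕜)).2 this
  set k : 𝕜 := d + 2 * (α : 𝕜) - 2
  rcases n.eq_zero_or_pos with rfl | hn
  · rw [totalDegree_eq_zero_iff_eq_C.1 (Nat.le_zero.1 hdeg)]
    simp [ballOpTilde, ballOp, laplace_apply, polyFun]
  -- Conjugating the coefficients of `q` turns the sesquilinear condition into a bilinear one.
  have horth' (q : MvPolynomial (Fin d) 𝕜) (hq : q.totalDegree < n) : sobolevForm A p q = 0 := by
    have h := horth (map (starRingEnd 𝕜) q) ((totalDegree_map_conj_le q).trans_lt hq)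
    rwa [innerH1_polyFun hd hα, map_conj_map_conj] at h
  -- The defect `f` has degree less than `n`, and by symmetry it is orthogonal to itself.
  set f := ballOpTilde k A p - ((n : 𝕜) * (n + k)) • p with hf
  have hfdeg : f.totalDegree < n := totalDegree_ballOpTilde_sub_lt k A hn hdeg
  have hf0 : innerH1 α (polyFun f) (polyFun f) = 0 := by
    have hc := (totalDegree_map_conj_le f).trans_lt hfdeg
    rw [innerH1_polyFun hd hα, hf, sobolevForm_sub_smul, hA.sobolevForm_ballOpTilde ha hA1,
      ← hf, horth' _ (totalDegree_ballOpTilde_lt k A hc), horth' _ hc, mul_zero, sub_zero]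
  have hfx := polyFun_eq_zero_of_innerH1_self hd hα hf0 x hx
  have he : polyFun f x = polyFun (ballOpTilde k A p) x - (n : 𝕜) * (n + k) * polyFun p x := by
    simp [hf, polyFun, smul_eval]
  rw [he, sub_eq_zero] at hfx
  rw [hfx]
  simp only [k]
  push_cast
  ring
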